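/- Let $K$ be a field, let $Q$ be a quiver with finitely many vertices, and let $L \ge 1$ be an integer. Let $KQ$ be the path algebra, where the product $p'p$ of two paths is "$p'$ after $p$" (and $0$ if $p'$ does not start where $p$ ends). Let $\Lambda = KQ/I$ be the truncated path algebra of Loewy length $L+1$, where $I$ is the ideal generated by all paths of length $L+1$. For a path $q$ in $KQ$ of length $\operatorname{len}(q) \le L$, denote its residue class in $\Lambda$ again by $q$; then $\Lambda q$ is the left ideal of $\Lambda$ generated by $q$, and $\operatorname{pdim} \Lambda q$ is its projective dimension as a left $\Lambda$-module. A vertex is called cyclebound if there is a path from it to a vertex lying on an oriented cycle. For a vertex $e$ let $c(e) \in \mathbb{N} \cup \{0, \infty\}$ be the supremum of the lengths of the paths in $KQ$ starting in $e$. Let $q$ be a path of length $l$ with $0 < l \le L$ and with terminal vertex $e$, and let $c = c(e)$. Then $$\operatorname{pdim} \Lambda q = \left[\frac{c}{L+1}\right] + \left[\frac{c+l}{L+1}\right],$$ where $[x]$ is the largest integer $\le x$, and the right-hand side is read as $\infty$ if $c = \infty$. In particular, $\operatorname{pdim} \Lambda q < \infty$ if and only if $c(e) < \infty$, and $c(e)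 < \infty$ if and only if $e$ is not cyclebound. Moreover, if $q'$ is another path that ends in $e$ with $L \ge \operatorname{len}(q') \ge \operatorname{len}(q) \ge 1$, then $$\operatorname{pdim} \Lambda q \le \operatorname{pdim} \Lambda q' \le 1 + \operatorname{pdim} \Lambda q.$$ -/

import Mathlib

namespace TruncatedPathAlgebra

universe u v w

/-- A path of the quiver `V` of arbitrary length `≥ 0`, bundled with its starting vertex and its
terminal vertex. -/
structure QPath (V : Type v) [Quiver.{w} V] where
  /-- the starting vertex -/
  source : V
  /-- the terminal vertex -/
  target : V
  /-- the path itself -/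
  path : Quiver.Path source target

/-- The underlying vector space of the path algebra `KQ`: the `K`-space with basis all paths. -/
def PathAlgebra (K : Type u) (V : Type v) [Field K] [Quiver.{w} V] : Type (max u v w) :=
  QPath V →₀ K

namespace PathAlgebra

variable {K : Type u} {V : Type v} [Field K] [Quiver.{w} V]

noncomputable instance : AddCommGroup (PathAlgebra K V) :=
  inferInstanceAs (AddCommGroup (QPath V →₀ K))

noncomputable instance : Module K (PathAlgebra K V) :=
  inferInstanceAs (Module K (QPath V →₀ K))

/-- A path of the quiver, as a basis element of the path algebra. -/
noncomputable def ofPath {a b : V} (p : Quiver.Path a b) : PathAlgebra K V :=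
  Finsupp.single (⟨a, b, p⟩ : QPath V) (1 : K)

open Classical in
/-- The product of two paths: `p' p` is the path `p'` after `p` if `p` ends where `p'` starts,
and `0` otherwise. -/
noncomputable def mulPath (p' p : QPath V) : PathAlgebra K V :=
  if h : p.target = p'.source then ofPath ((p.path.cast rfl h).comp p'.path) else 0

/-- The multiplication of the path algebra, the bilinear extension of the product of paths. -/
noncomputable def mulHom : PathAlgebra K V →ₗ[K] PathAlgebra K V →ₗ[K] PathAlgebra K V :=
  Finsupp.linearCombination K (fun p' : QPath V =>
    (Finsupp.linearCombination K (fun p : QPath V => (mulPath p' p : PathAlgebra K V)) :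
      PathAlgebra K V →ₗ[K] PathAlgebra K V))

noncomputable instance : Mul (PathAlgebra K V) := ⟨fun x y => mulHom x y⟩

/-- The identity of the path algebra is the sum of all paths of length zero. -/
noncomputable instance [Fintype V] : One (PathAlgebra K V) :=
  ⟨∑ a : V, ofPath (Quiver.Path.nil : Quiver.Path a a)⟩

theorem mul_def (x y : PathAlgebra K V) : x * y = mulHom x y := rfl

theorem one_def [Fintype V] :
    (1 : PathAlgebra K V) = ∑ a : V, ofPath (Quiver.Path.nil : Quiver.Path a a) := rfl

theorem ofPath_mul_ofPath {a b a' b' : V} (p' : Quiver.Path a' b') (p : Quiver.Path a b) :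
    (ofPath p' * ofPath p : PathAlgebra K V) = mulPath ⟨a', b', p'⟩ ⟨a, b, p⟩ := by
  rw [mul_def]
  unfold mulHom ofPath
  erw [Finsupp.linearCombination_single, one_smul, Finsupp.linearCombination_single, one_smul]

theorem ofPath_mul_ofPath_of_eq {a b c : V} (p' : Quiver.Path b c) (p : Quiver.Path a b) :
    (ofPath p' * ofPath p : PathAlgebra K V) = ofPath (p.comp p') := by
  rw [ofPath_mul_ofPath, mulPath, dif_pos rfl]
  rfl

theorem ofPath_mul_ofPath_of_ne {a b a' b' : V} (p' : Quiver.Path a' b') (p : Quiver.Path a b)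
    (h : b ≠ a') : (ofPath p' * ofPath p : PathAlgebra K V) = 0 := by
  rw [ofPath_mul_ofPath, mulPath, dif_neg h]

@[elab_as_elim]
theorem induction_on {motive : PathAlgebra K V → Prop} (x : PathAlgebra K V)
    (zero : motive 0) (add : ∀ x y, motive x → motive y → motive (x + y))
    (smul : ∀ (k : K) {a b : V} (p : Quiver.Path a b), motive (k • ofPath p)) : motive x := by
  refine Finsupp.induction_linear (motive := motive) x zero add ?_
  rintro ⟨a, b, p⟩ k
  have h := smul k p
  unfold ofPath at h
  erw [Finsupp.smul_single, smul_eq_mul, mul_one] at h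
  exact h

theorem add_mul' (x y z : PathAlgebra K V) : (x + y) * z = x * z + y * z := by
  simp only [mul_def, map_add, LinearMap.add_apply]

theorem mul_add' (x y z : PathAlgebra K V) : x * (y + z) = x * y + x * z := by
  simp only [mul_def, map_add]

theorem smul_mul' (k : K) (x y : PathAlgebra K V) : (k • x) * y = k • (x * y) := by
  simp only [mul_def, map_smul, LinearMap.smul_apply]

theorem mul_smul' (k : K) (x y : PathAlgebra K V) : x * (k • y) = k • (x * y) := by
  simp only [mul_def, map_smul]

theorem zero_mul' (x : PathAlgebra K V) : 0 * x = 0 := by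
  simp only [mul_def, map_zero, LinearMap.zero_apply]

theorem mul_zero' (x : PathAlgebra K V) : x * 0 = 0 := by
  simp only [mul_def, map_zero]

theorem mul_assoc' (x y z : PathAlgebra K V) : x * y * z = x * (y * z) := by
  induction x using induction_on with
  | zero => simp only [zero_mul']
  | add x₁ x₂ h₁ h₂ => simp only [add_mul', h₁, h₂]
  | smul k p =>
    induction y using induction_on with
    | zero => simp only [zero_mul', mul_zero']
    | add y₁ y₂ h₁ h₂ => simp only [add_mul', mul_add', h₁, h₂]
    | smul m q =>
      induction z using induction_on with
      | zero => simp only [mul_zero']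
      | add z₁ z₂ h₁ h₂ => simp only [mul_add', h₁, h₂]
      | smul n r =>
        simp only [smul_mul', mul_smul']
        congr 3
        rename_i a₁ b₁ a₂ b₂ a₃ b₃
        by_cases h₁ : b₂ = a₁
        · subst h₁
          by_cases h₂ : b₃ = a₂
          · subst h₂
            simp only [ofPath_mul_ofPath_of_eq, Quiver.Path.comp_assoc]
          · simp only [ofPath_mul_ofPath_of_eq, ofPath_mul_ofPath_of_ne _ _ h₂, mul_zero']
        · by_cases h₂ : b₃ = a₂
          · subst h₂
            simp only [ofPath_mul_ofPath_of_eq, ofPath_mul_ofPath_of_ne _ _ h₁, zero_mul']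
          · simp only [ofPath_mul_ofPath_of_ne _ _ h₁, ofPath_mul_ofPath_of_ne _ _ h₂,
              zero_mul', mul_zero']

theorem one_mul' [Fintype V] (x : PathAlgebra K V) : 1 * x = x := by
  induction x using induction_on with
  | zero => exact mul_zero' 1
  | add x y hx hy => rw [mul_add', hx, hy]
  | smul k p =>
    rename_i a b
    rw [mul_smul', one_def, mul_def, map_sum, LinearMap.sum_apply, Finset.sum_eq_single b]
    · rw [← mul_def, ofPath_mul_ofPath_of_eq, Quiver.Path.comp_nil]
    · intro c _ hc
      rw [← mul_def, ofPath_mul_ofPath_of_ne _ _ hc.symm]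
    · simp

theorem mul_one' [Fintype V] (x : PathAlgebra K V) : x * 1 = x := by
  induction x using induction_on with
  | zero => exact zero_mul' 1
  | add x y hx hy => rw [add_mul', hx, hy]
  | smul k p =>
    rename_i a b
    rw [smul_mul', one_def, mul_def, map_sum, Finset.sum_eq_single a]
    · rw [← mul_def, ofPath_mul_ofPath_of_eq, Quiver.Path.nil_comp]
    · intro c _ hc
      rw [← mul_def, ofPath_mul_ofPath_of_ne _ _ hc]
    · simp

/-- The path algebra `KQ` of a quiver with finitely many vertices is a ring with identity. -/
noncomputable instance [Fintype V] : Ring (PathAlgebra K V) :=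
  { (inferInstance : AddCommGroup (PathAlgebra K V)) with
    mul := (· * ·)
    one := 1
    left_distrib := mul_add'
    right_distrib := add_mul'
    zero_mul := zero_mul'
    mul_zero := mul_zero'
    mul_assoc := mul_assoc'
    one_mul := one_mul'
    mul_one := mul_one' }

noncomputable instance [Fintype V] : Algebra K (PathAlgebra K V) :=
  Algebra.ofModule smul_mul' mul_smul'

end PathAlgebra

variable (K : Type u) (V : Type v) [Field K] [Quiver.{w} V] [Fintype V]

/-- The two-sided ideal of `KQ` generated by all paths of length `L + 1`. -/
noncomputable def truncationIdeal (L : ℕ) : TwoSidedIdeal (PathAlgebra K V) :=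
  TwoSidedIdeal.span
    {x | ∃ (a b : V) (p : Quiver.Path a b), p.length = L + 1 ∧ x = PathAlgebra.ofPath p}

/-- The truncated path algebra `Λ = KQ/I` of Loewy length `L + 1`. -/
abbrev TruncatedAlgebra (L : ℕ) : Type (max u v w) :=
  (truncationIdeal K V L).ringCon.Quotient

variable {V}

/-- The residue class in `Λ` of a path of the quiver. -/
noncomputable def residue (L : ℕ) {a b : V} (q : Quiver.Path a b) : TruncatedAlgebra K V L :=
  (truncationIdeal K V L).ringCon.mk' (PathAlgebra.ofPath q)

/-- The projective dimension of the left `Λ`-module `Λ q`, the left ideal of `Λ` generated by the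
residue class of the path `q`. -/
noncomputable def pdimPath (L : ℕ) {a b : V} (q : Quiver.Path a b) : WithBot ℕ∞ :=
  CategoryTheory.projectiveDimension
    (ModuleCat.of (TruncatedAlgebra K V L)
      (Ideal.span {residue K L q} : Ideal (TruncatedAlgebra K V L)))

/-- `c(e)`: the supremum of the lengths of the paths in `KQ` starting in the vertex `e`. -/
noncomputable def supLength {V : Type v} [Quiver.{w} V] (e : V) : ℕ∞ :=
  ⨆ (b : V) (p : Quiver.Path e b), (p.length : ℕ∞)

/-- A vertex `e` is cyclebound if there is a path from `e` to a vertex lying on an oriented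
cycle. -/
def Cyclebound {V : Type v} [Quiver.{w} V] (e : V) : Prop :=
  ∃ b : V, Nonempty (Quiver.Path e b) ∧ ∃ z : Quiver.Path b b, 0 < z.length

/-- The `l`-degree `[c / (L + 1)] + [(c + l) / (L + 1)]` of `c`, with value `∞` at `c = ∞`. -/
def lDegree (L l : ℕ) (c : ℕ∞) : ℕ∞ :=
  ENat.recTopCoe (C := fun _ => ℕ∞) ⊤
    (fun n : ℕ => ((n / (L + 1) + (n + l) / (L + 1) : ℕ) : ℕ∞)) c

end TruncatedPathAlgebra

namespace TruncatedPathAlgebra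

universe u v w

/-! ### Unique factorization of paths -/

section Paths

variable {V : Type*} [Quiver V]

/-! The engine is an explicit syzygy. Right multiplication by `q` maps `Λe` onto `Λq`. Since the
paths of length at most `L` form a basis of `Λ`, its kernel is spanned by the paths `p` from `e`
with `len(p) + len(q) > L`. Each of these extends a unique path of length `k = L + 1 - len(q)`, so
the kernel is the direct sum of the left ideals `Λp` over the paths `p` of length `k` starting in
`e` (`syzygySequence_shortExact`). The module `Λe` is projective, and `0 < k ≤ L`, so the summands
are of the same kind as `Λq` and the construction iterates.

Dimension shifting, together with the fact that a direct sum has projective dimension below `n` iff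
every summand does, reduces everything to path lengths. `Λq` is projective iff no path of length `k`
starts in `e` (`projective_pathIdeal_iff`). In general `pdim Λq ≤ n` iff `c(e) < T(l, n)`, where `l
= len(q)`, `T(l, 0) = L + 1 - l` and `T(l, n + 1) = (L + 1 - l) + T(L + 1 - l, n)`: a path from `e`
is cut after `k` arrows, and the remainder is measured at the new vertex. The closed formula
satisfies the same recursion (`div_add_div_lt_iff`), because lowering `c` by `L + 1 - l` and
replacing `l` by `L + 1 - l` lowers it by exactly one. The remaining claims are finiteness of the
quiver and monotonicity of the formula in `l`. -/

theorem QPath.eq_of_comp_eq_comp {a b b' c : V} (p : Quiver.Path a b) (p' : Quiver.Path a b')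
    (s : Quiver.Path b c) (s' : Quiver.Path b' c) (hl : p.length = p'.length)
    (h : p.comp s = p'.comp s') : (⟨a, b, p⟩ : QPath V) = ⟨a, b', p'⟩ := by
  induction s with
  | nil =>
    cases s' with
    | nil => simp only [Quiver.Path.comp_nil] at h; rw [h]
    | cons s' f =>
      have := congrArg Quiver.Path.length h
      simp [Quiver.Path.length_comp] at this
      omega
  | cons s g ih =>
    cases s' with
    | nil =>
      have := congrArg Quiver.Path.length h
      simp [Quiver.Path.length_comp] at this
      omega
    | cons s' f =>
      simp only [Quiver.Path.comp_cons, Quiver.Path.cons.injEq] at h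
      obtain rfl := h.1
      exact ih s' h.2.1.eq

theorem exists_comp_eq_of_le_length {a c : V} (p : Quiver.Path a c) {k : ℕ} (hk : k ≤ p.length) :
    ∃ (b : V) (r : Quiver.Path a b) (s : Quiver.Path b c), r.length = k ∧ p = r.comp s := by
  induction p with
  | nil => exact ⟨a, .nil, .nil, (Nat.le_zero.1 hk).symm, rfl⟩
  | @cons b c p f ih =>
    rcases Nat.lt_or_ge p.length k with h | h
    · exact ⟨c, p.cons f, .nil, by simp at hk ⊢; omega, rfl⟩
    · obtain ⟨d, r, s, hr, rfl⟩ := ih h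
      exact ⟨d, r, s.cons f, hr, rfl⟩

end Paths

/-! ### Coefficients of products in the path algebra -/

namespace PathAlgebra

variable {K : Type u} {V : Type v} [Field K] [Quiver.{w} V]

/-- The coefficient of a path in an element of the path algebra. -/
noncomputable def coeff (t : QPath V) : PathAlgebra K V →ₗ[K] K := Finsupp.lapply t

theorem coeff_ofPath_self {a b : V} (p : Quiver.Path a b) :
    coeff ⟨a, b, p⟩ (ofPath p : PathAlgebra K V) = 1 := by
  unfold coeff ofPath
  erw [Finsupp.lapply_apply, Finsupp.single_eq_same]

theorem coeff_ofPath_of_ne {a b : V} (p : Quiver.Path a b) {t : QPath V} (h : t ≠ ⟨a, b, p⟩) :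
    coeff t (ofPath p : PathAlgebra K V) = 0 := by
  unfold coeff ofPath
  erw [Finsupp.lapply_apply, Finsupp.single_eq_of_ne h]

/-- Reduces a membership question to the scalar multiples of single paths in the support. -/
theorem mem_of_coeff_ne_zero (S : AddSubmonoid (PathAlgebra K V)) (x : PathAlgebra K V)
    (h : ∀ {a b : V} (p : Quiver.Path a b), coeff ⟨a, b, p⟩ x ≠ 0 →
      ∀ k : K, k • ofPath p ∈ S) : x ∈ S := by
  have hx : x = Finsupp.sum x fun t k => (k • ofPath t.path : PathAlgebra K V) := by
    conv_lhs => rw [← Finsupp.sum_single x]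
    refine Finsupp.sum_congr fun t _ => ?_
    unfold ofPath
    erw [Finsupp.smul_single, smul_eq_mul, mul_one]
  rw [hx]
  exact AddSubmonoid.sum_mem _ fun t ht => h t.path (Finsupp.mem_support_iff.1 ht) _

theorem exists_comp_of_coeff_mul_ofPath_ne_zero {a b : V} (p : Quiver.Path a b)
    (y : PathAlgebra K V) {t : QPath V} (h : coeff t (y * ofPath p) ≠ 0) :
    ∃ (c : V) (s : Quiver.Path b c), t = ⟨a, c, p.comp s⟩ := by
  contrapose! h
  induction y using induction_on with
  | zero => rw [zero_mul', map_zero]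
  | add x y hx hy => rw [add_mul', map_add, hx, hy, add_zero]
  | smul k s =>
    rename_i b' c
    rw [smul_mul', map_smul]
    by_cases hb : b = b'
    · subst hb
      rw [ofPath_mul_ofPath_of_eq, coeff_ofPath_of_ne _ (h c s), smul_zero]
    · rw [ofPath_mul_ofPath_of_ne _ _ hb, map_zero, smul_zero]

/-- Distinct continuations of `p` give distinct paths, so right multiplication by `p` merely
relabels the basis paths starting in `b`. -/
theorem coeff_comp_mul_ofPath {a b c : V} (p : Quiver.Path a b) (s : Quiver.Path b c)
    (y : PathAlgebra K V) : coeff ⟨a, c, p.comp s⟩ (y * ofPath p) = coeff ⟨b, c, s⟩ y := by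
  induction y using induction_on with
  | zero => rw [zero_mul', map_zero, map_zero]
  | add x y hx hy => rw [add_mul', map_add, map_add, hx, hy]
  | smul k s' =>
    rename_i b' c'
    rw [smul_mul', map_smul, map_smul]
    congr 1
    by_cases hb : b = b'
    · subst hb
      rw [ofPath_mul_ofPath_of_eq]
      by_cases hs : (⟨b, c, s⟩ : QPath V) = ⟨b, c', s'⟩
      · cases hs
        rw [coeff_ofPath_self, coeff_ofPath_self]
      · rw [coeff_ofPath_of_ne _ hs, coeff_ofPath_of_ne]
        intro h
        apply hs
        obtain rfl : c = c' := congrArg QPath.target h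
        simp only [QPath.mk.injEq, heq_eq_eq, true_and] at h
        rw [Quiver.Path.comp_injective_right p h]
    · rw [ofPath_mul_ofPath_of_ne _ _ hb, map_zero, coeff_ofPath_of_ne]
      exact fun h => hb (congrArg QPath.source h)

/-- By length, only the trivial path at `a` can contribute `p` to the product. -/
theorem coeff_ofPath_mul {a b : V} (p : Quiver.Path a b) (y : PathAlgebra K V) :
    coeff ⟨a, b, p⟩ (ofPath p * y) = coeff ⟨a, a, .nil⟩ y := by
  induction y using induction_on with
  | zero => rw [mul_zero', map_zero, map_zero]
  | add x y hx hy => rw [mul_add', map_add, map_add, hx, hy]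
  | smul k s =>
    rename_i c d
    rw [mul_smul', map_smul, map_smul]
    congr 1
    by_cases hs : (⟨a, a, .nil⟩ : QPath V) = ⟨c, d, s⟩
    · cases hs
      rw [ofPath_mul_ofPath_of_eq, Quiver.Path.nil_comp, coeff_ofPath_self, coeff_ofPath_self]
    · rw [coeff_ofPath_of_ne _ hs]
      by_cases hd : d = a
      · subst hd
        rw [ofPath_mul_ofPath_of_eq, coeff_ofPath_of_ne]
        intro h
        apply hs
        obtain rfl : d = c := congrArg QPath.source h
        simp only [QPath.mk.injEq, heq_eq_eq, true_and] at h
        have hl := congrArg Quiver.Path.length h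
        rw [Quiver.Path.length_comp] at hl
        rw [Quiver.Path.eq_nil_of_length_zero s (by omega)]
      · rw [ofPath_mul_ofPath_of_ne _ _ hd, map_zero]

end PathAlgebra

/-! ### A basis of the truncated algebra -/

section Truncation

open PathAlgebra

variable (K : Type u) (V : Type v) [Field K] [Quiver.{w} V] [Fintype V]

/-- The ideal of all elements whose coefficients at the paths of length `≤ L` vanish. -/
noncomputable def lengthIdeal (L : ℕ) : TwoSidedIdeal (PathAlgebra K V) :=
  TwoSidedIdeal.mk' {x | ∀ t : QPath V, t.path.length ≤ L → coeff t x = 0}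
    (fun t _ => map_zero _)
    (fun {x y} hx hy t ht => by rw [map_add, hx t ht, hy t ht, add_zero])
    (fun {x} hx t ht => by rw [map_neg, hx t ht, neg_zero])
    (fun {x y} hy t ht => by
      by_contra h
      refine h ?_
      clear h
      refine mem_of_coeff_ne_zero
        (AddSubmonoid.comap (AddMonoidHom.mulLeft x) (AddMonoidHom.mker (coeff t).toAddMonoidHom))
        y fun {a b} p hp k => ?_
      have hl : L < p.length := by
        by_contra hl
        exact hp (hy _ (not_lt.1 hl))
      change coeff t (x * k • ofPath p) = 0
      rw [PathAlgebra.mul_smul', map_smul]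
      by_contra h
      obtain ⟨c, s, rfl⟩ := exists_comp_of_coeff_mul_ofPath_ne_zero p x
        (fun h' => h (by rw [h', smul_zero]))
      simp only [Quiver.Path.length_comp] at ht
      omega)
    (fun {x y} hx t ht => by
      refine induction_on (motive := fun y => coeff t (x * y) = 0) y ?_ ?_ ?_
      · rw [PathAlgebra.mul_zero', map_zero]
      · intro y z hy hz
        rw [PathAlgebra.mul_add', map_add, hy, hz, add_zero]
      · intro k a b p
        rw [PathAlgebra.mul_smul', map_smul]
        by_contra h
        have h' : coeff t (x * ofPath p) ≠ 0 := fun h' => h (by rw [h', smul_zero])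
        obtain ⟨c, s, rfl⟩ := exists_comp_of_coeff_mul_ofPath_ne_zero p x h'
        rw [coeff_comp_mul_ofPath] at h'
        simp only [Quiver.Path.length_comp] at ht
        exact h' (hx _ (by simp only; omega)))

variable {K V}

theorem mem_lengthIdeal {L : ℕ} {x : PathAlgebra K V} :
    x ∈ lengthIdeal K V L ↔ ∀ t : QPath V, t.path.length ≤ L → coeff t x = 0 :=
  TwoSidedIdeal.mem_mk' _ _ _ _ _ _ _

theorem ofPath_mem_truncationIdeal {L : ℕ} {a b : V} (p : Quiver.Path a b) (h : L < p.length) :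
    ofPath p ∈ truncationIdeal K V L := by
  obtain ⟨c, r, s, hr, rfl⟩ := exists_comp_eq_of_le_length p (k := L + 1) h
  rw [← ofPath_mul_ofPath_of_eq]
  exact TwoSidedIdeal.mul_mem_left _ _ _ (TwoSidedIdeal.subset_span ⟨_, _, r, hr, rfl⟩)

/-- Makes the coefficients at paths of length at most `L` well defined and jointly faithful on `Λ`.
The nontrivial inclusion holds because a longer path has an initial segment of length exactly `L +
1`. -/
theorem truncationIdeal_eq_lengthIdeal (L : ℕ) :
    truncationIdeal K V L = lengthIdeal K V L := by
  apply le_antisymm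
  · refine TwoSidedIdeal.span_le.2 ?_
    rintro _ ⟨a, b, p, hp, rfl⟩
    refine mem_lengthIdeal.2 fun t ht => coeff_ofPath_of_ne _ ?_
    rintro rfl
    simp only at ht
    omega
  · intro x hx
    refine mem_of_coeff_ne_zero (truncationIdeal K V L).asIdeal.toAddSubmonoid x
      fun {a b} p hp k => ?_
    have hl : L < p.length := by
      by_contra hl
      exact hp (mem_lengthIdeal.1 hx _ (not_lt.1 hl))
    change k • ofPath p ∈ truncationIdeal K V L
    -- A ring ideal absorbs the scalar `k` as left multiplication by `k • 1`.
    rw [← one_mul (ofPath p), ← PathAlgebra.smul_mul']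
    exact TwoSidedIdeal.mul_mem_left _ _ _ (ofPath_mem_truncationIdeal p hl)

variable (K V) in
/-- The quotient map from the path algebra onto the truncated path algebra. -/
noncomputable abbrev toTruncated (L : ℕ) : PathAlgebra K V →+* TruncatedAlgebra K V L :=
  (truncationIdeal K V L).ringCon.mk'

theorem toTruncated_surjective (L : ℕ) : Function.Surjective (toTruncated K V L) :=
  RingCon.mk'_surjective _

theorem toTruncated_eq_zero_iff {L : ℕ} {x : PathAlgebra K V} :
    toTruncated K V L x = 0 ↔ ∀ t : QPath V, t.path.length ≤ L → coeff t x = 0 := by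
  rw [← mem_lengthIdeal, ← truncationIdeal_eq_lengthIdeal, TwoSidedIdeal.mem_iff,
    ← map_zero (toTruncated K V L)]
  exact RingCon.eq _

open Classical in
/-- The coefficient of a path of length `≤ L` in an element of the truncated path algebra; it is
`0` by convention for longer paths. -/
noncomputable def truncCoeff (L : ℕ) (t : QPath V) : TruncatedAlgebra K V L →+ K :=
  (truncationIdeal K V L).ringCon.toAddCon.lift
    (if t.path.length ≤ L then (coeff t).toAddMonoidHom else 0) (by
      intro x y h
      have h' : toTruncated K V L (x - y) = 0 := by
        rw [map_sub, sub_eq_zero]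
        exact (RingCon.eq _).2 h
      rw [toTruncated_eq_zero_iff] at h'
      rw [AddCon.ker_rel]
      split_ifs with ht
      · have := h' t ht
        rwa [map_sub, sub_eq_zero] at this
      · rfl)

theorem truncCoeff_toTruncated {L : ℕ} {t : QPath V} (ht : t.path.length ≤ L)
    (x : PathAlgebra K V) : truncCoeff L t (toTruncated K V L x) = coeff t x := by
  change (if t.path.length ≤ L then (coeff t).toAddMonoidHom else 0 : PathAlgebra K V →+ K) x = _
  rw [if_pos ht]
  rfl

theorem eq_zero_of_truncCoeff {L : ℕ} {x : TruncatedAlgebra K V L}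
    (h : ∀ t : QPath V, t.path.length ≤ L → truncCoeff L t x = 0) : x = 0 := by
  obtain ⟨x, rfl⟩ := toTruncated_surjective L x
  exact toTruncated_eq_zero_iff.2 fun t ht => (truncCoeff_toTruncated ht x).symm.trans (h t ht)

variable (K) in
theorem residue_comp (L : ℕ) {a b c : V} (p : Quiver.Path a b) (s : Quiver.Path b c) :
    residue K L (p.comp s) = residue K L s * residue K L p := by
  unfold residue
  rw [← ofPath_mul_ofPath_of_eq, map_mul]

variable (K) in
theorem residue_eq_zero {L : ℕ} {a b : V} (p : Quiver.Path a b) (h : L < p.length) :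
    residue K L p = 0 := by
  refine toTruncated_eq_zero_iff.2 fun t ht => coeff_ofPath_of_ne _ ?_
  rintro rfl
  exact absurd ht (not_le.2 h)

variable (K) in
theorem residue_ne_zero {L : ℕ} {a b : V} (p : Quiver.Path a b) (h : p.length ≤ L) :
    residue K L p ≠ 0 := by
  intro h0
  have := toTruncated_eq_zero_iff.1 h0 ⟨a, b, p⟩ h
  rw [coeff_ofPath_self] at this
  exact one_ne_zero this

end Truncation

/-! ### Projective dimension of direct sums -/

open CategoryTheory in
-- Dimension shifting along the direct sum of the sequences, whose middle term is again projective.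
theorem hasProjectiveDimensionLT_dfinsupp_of_exact {R : Type u} [Ring R] {ι : Type v} (n : ℕ)
    {A B C : ι → Type (max u v)} [∀ i, AddCommGroup (A i)] [∀ i, Module R (A i)]
    [∀ i, AddCommGroup (B i)] [∀ i, Module R (B i)] [∀ i, AddCommGroup (C i)]
    [∀ i, Module R (C i)] (f : ∀ i, A i →ₗ[R] B i) (g : ∀ i, B i →ₗ[R] C i)
    (hf : ∀ i, Function.Injective (f i)) (hfg : ∀ i, Function.Exact (f i) (g i))
    (hg : ∀ i, Function.Surjective (g i)) [∀ i, Module.Projective R (B i)]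
    (h : HasProjectiveDimensionLT (ModuleCat.of R (Π₀ i, A i)) (n + 1)) :
    HasProjectiveDimensionLT (ModuleCat.of R (Π₀ i, C i)) (n + 2) := by
  have hexact : Function.Exact (DFinsupp.mapRange.linearMap f) (DFinsupp.mapRange.linearMap g) := by
    refine fun x => ⟨fun hx => ?_, ?_⟩
    · classical
      have hx' (i : ι) : ∃ y, f i y = x i := (hfg i _).1 (DFunLike.congr_fun hx i)
      choose y hy using hx'
      -- The chosen preimages need not vanish where `x` does, so they are cut off outside its
      -- support.
      refine ⟨DFinsupp.mk x.support fun i => y i, DFinsupp.ext fun i => ?_⟩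
      rw [DFinsupp.mapRange.linearMap_apply, DFinsupp.mapRange_apply, DFinsupp.mk_apply]
      split_ifs with hi
      · exact hy i
      · rw [map_zero, DFinsupp.notMem_support_iff.1 hi]
    · rintro ⟨y, rfl⟩
      exact DFinsupp.ext fun i => (hfg i).apply_apply_eq_zero (y i)
  let S : ShortComplex (ModuleCat.{max u v} R) := ShortComplex.mk
    (X₁ := ModuleCat.of R (Π₀ i, A i)) (X₂ := ModuleCat.of R (Π₀ i, B i))
    (X₃ := ModuleCat.of R (Π₀ i, C i))
    (ModuleCat.ofHom (DFinsupp.mapRange.linearMap f))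
    (ModuleCat.ofHom (DFinsupp.mapRange.linearMap g))
    (ModuleCat.hom_ext hexact.linearMap_comp_eq_zero)
  have hS : S.ShortExact := ModuleCat.shortComplex_shortExact S hexact
    ((DFinsupp.mapRange_injective _ fun _ => map_zero _).2 hf)
    ((DFinsupp.mapRange_surjective _ fun _ => map_zero _).2 hg)
  exact (hS.hasProjectiveDimensionLT_X₃_iff n
    ((IsProjective.iff_projective (Π₀ i, B i)).1 inferInstance)).2 h

open CategoryTheory in
-- Induction through the kernels of the free covers `M i →₀ R → M i`. The shift starts only at bound
-- 2, so the zero and projective cases are separate.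
theorem hasProjectiveDimensionLT_dfinsupp {R : Type u} [Ring R] {ι : Type v} (n : ℕ) :
    ∀ (M : ι → Type (max u v)) [∀ i, AddCommGroup (M i)] [∀ i, Module R (M i)],
      (∀ i, HasProjectiveDimensionLT (ModuleCat.of R (M i)) n) →
        HasProjectiveDimensionLT (ModuleCat.of R (Π₀ i, M i)) n := by
  induction n with
  | zero =>
    intro M _ _ h
    simp only [hasProjectiveDimensionLT_zero_iff_isZero, ModuleCat.isZero_of_iff_subsingleton] at h ⊢
    exact ⟨fun x y => DFinsupp.ext fun i => Subsingleton.elim _ _⟩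
  | succ n ih =>
    cases n with
    | zero =>
      intro M _ _ h
      simp only [zero_add, ← projective_iff_hasProjectiveDimensionLT_one,
        ← IsProjective.iff_projective] at h ⊢
      infer_instance
    | succ n =>
      intro M _ _ h
      have hg (i : ι) : Function.Surjective (Finsupp.linearCombination R (id : M i → M i)) :=
        fun x => ⟨Finsupp.single x 1, by rw [Finsupp.linearCombination_single, one_smul, id]⟩
      refine hasProjectiveDimensionLT_dfinsupp_of_exact n
        (A := fun i => LinearMap.ker (Finsupp.linearCombination R (id : M i → M i)))
        (fun i => (LinearMap.ker (Finsupp.linearCombination R (id : M i → M i))).subtype)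
        (fun i => Finsupp.linearCombination R (id : M i → M i))
        (fun i => Subtype.val_injective) (fun i => LinearMap.exact_subtype_ker_map (Finsupp.linearCombination R (id : M i → M i))) hg
        (ih _ fun i => ?_)
      exact ((LinearMap.shortExact_shortComplexKer (hg i)).hasProjectiveDimensionLT_X₃_iff n
        ((IsProjective.iff_projective (M i →₀ R)).1 inferInstance)).1 (h i)

open CategoryTheory in
-- For the converse, each summand is a retract of the sum.
theorem hasProjectiveDimensionLT_dfinsupp_iff {R : Type u} [Ring R] {ι : Type v} (n : ℕ)
    (M : ι → Type (max u v)) [∀ i, AddCommGroup (M i)] [∀ i, Module R (M i)] :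
    HasProjectiveDimensionLT (ModuleCat.of R (Π₀ i, M i)) n ↔
      ∀ i, HasProjectiveDimensionLT (ModuleCat.of R (M i)) n := by
  classical
  refine ⟨fun h i => ?_, hasProjectiveDimensionLT_dfinsupp n M⟩
  let r : Retract (ModuleCat.of R (M i)) (ModuleCat.of R (Π₀ i, M i)) :=
    { i := ModuleCat.ofHom (DFinsupp.lsingle i)
      r := ModuleCat.ofHom (DFinsupp.lapply i)
      retract := by ext x; simp }
  exact r.hasProjectiveDimensionLT n

/-! ### Lengths of paths and cycles -/

section Combinatorics

variable {V : Type v} [Quiver.{w} V]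

/-- The lengths that occur are closed downwards, by passing to initial segments. -/
theorem natCast_le_supLength_iff {e : V} {m : ℕ} :
    (m : ℕ∞) ≤ supLength e ↔ ∃ (b : V) (p : Quiver.Path e b), p.length = m := by
  constructor
  · intro h
    cases m with
    | zero => exact ⟨e, .nil, rfl⟩
    | succ m =>
      have h' : (m : ℕ∞) < supLength e := lt_of_lt_of_le (by exact_mod_cast Nat.lt_succ_self m) h
      simp only [supLength, lt_iSup_iff, Nat.cast_lt] at h'
      obtain ⟨b, p, hp⟩ := h'
      obtain ⟨c, r, -, hr, -⟩ := exists_comp_eq_of_le_length p (k := m + 1) hp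
      exact ⟨c, r, hr⟩
  · rintro ⟨b, p, rfl⟩
    exact le_iSup₂ (f := fun (b : V) (p : Quiver.Path e b) => (p.length : ℕ∞)) b p

theorem supLength_lt_natCast_iff {e : V} {m : ℕ} :
    supLength e < m ↔ ∀ (b : V) (p : Quiver.Path e b), p.length ≠ m := by
  rw [← not_le, natCast_le_supLength_iff]
  push Not
  rfl

/-- Cutting a path after `k` arrows; this mirrors the recursion of `degreeThreshold`. -/
theorem supLength_lt_natCast_add_iff {e : V} {k m : ℕ} :
    supLength e < (k + m : ℕ) ↔
      ∀ (b : V) (p : Quiver.Path e b), p.length = k → supLength b < m := by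
  simp only [supLength_lt_natCast_iff]
  constructor
  · intro h b p hp c r hr
    exact h c (p.comp r) (by rw [Quiver.Path.length_comp, hp, hr])
  · intro h c p hp
    obtain ⟨b, r, s, hr, rfl⟩ := exists_comp_eq_of_le_length p (k := k) (by omega)
    rw [Quiver.Path.length_comp] at hp
    exact h b r hr c s (by omega)

/-- A path `p` starting in a vertex that is not cyclebound makes the set of reachable vertices
shrink by at least `p.length`. -/
theorem length_add_card_reachable_le [Fintype V] {e b : V} (he : ¬ Cyclebound e)
    (p : Quiver.Path e b) :
    p.length + Nat.card {c : V // Nonempty (Quiver.Path b c)} ≤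
      Nat.card {c : V // Nonempty (Quiver.Path e c)} := by
  induction p with
  | nil => simp
  | @cons b c p f ih =>
    have hlt : Nat.card {d : V // Nonempty (Quiver.Path c d)} <
        Nat.card {d : V // Nonempty (Quiver.Path b d)} := by
      refine Set.ncard_lt_ncard (s := {d | Nonempty (Quiver.Path c d)})
        (t := {d | Nonempty (Quiver.Path b d)}) ⟨?_, fun h => ?_⟩ (Set.toFinite _)
      · rintro d ⟨r⟩
        exact ⟨f.toPath.comp r⟩
      -- If `b` stayed reachable from `c`, the arrow `f` and the way back would form a cycle
      -- reachable from `e`.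
      · obtain ⟨r⟩ : Nonempty (Quiver.Path c b) := h ⟨.nil⟩
        exact he ⟨b, ⟨p⟩, f.toPath.comp r, by rw [Quiver.Path.length_comp]; simp⟩
    rw [Quiver.Path.length_cons]
    omega

/-- Running around a cycle gives arbitrarily long paths; without one, the number of reachable
vertices bounds the length. -/
theorem supLength_lt_top_iff_not_cyclebound [Fintype V] (e : V) :
    supLength e < ⊤ ↔ ¬ Cyclebound e := by
  constructor
  · rintro h ⟨b, ⟨p⟩, z, hz⟩
    have key (m : ℕ) : ∃ r : Quiver.Path e b, m ≤ r.length := by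
      induction m with
      | zero => exact ⟨p, Nat.zero_le _⟩
      | succ m ih =>
        obtain ⟨r, hr⟩ := ih
        exact ⟨r.comp z, by rw [Quiver.Path.length_comp]; omega⟩
    obtain ⟨m, hm⟩ := ENat.ne_top_iff_exists.1 h.ne
    obtain ⟨r, hr⟩ := key (m + 1)
    have := natCast_le_supLength_iff.2 ⟨b, r, rfl⟩
    rw [← hm, Nat.cast_le] at this
    omega
  · intro h
    refine lt_of_le_of_lt (iSup₂_le fun b p => ?_)
      (ENat.natCast_lt_top (Nat.card {c : V // Nonempty (Quiver.Path e c)}))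
    have := length_add_card_reachable_le h p
    exact_mod_cast (by omega)

end Combinatorics

/-! ### Arithmetic of the closed formula -/

/-- The least `c` for which `[c / (L + 1)] + [(c + l) / (L + 1)]` exceeds `n`. -/
def degreeThreshold (L : ℕ) : ℕ → ℕ → ℕ
  | l, 0 => L + 1 - l
  | l, n + 1 => (L + 1 - l) + degreeThreshold L (L + 1 - l) n

theorem div_add_div_lt_iff {L l : ℕ} (hl : 0 < l) (hL : l ≤ L) (n c : ℕ) :
    c / (L + 1) + (c + l) / (L + 1) < n + 1 ↔ c < degreeThreshold L l n := by
  have small {c l : ℕ} (hl : 0 < l) (h : c < L + 1 - l) :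
      c / (L + 1) + (c + l) / (L + 1) = 0 := by
    rw [Nat.div_eq_of_lt (by omega), Nat.div_eq_of_lt (by omega)]
  -- With `c = (L + 1 - l) + c'` one has `c + l = c' + (L + 1)`: the two quotients exchange roles
  -- and one of them gains 1.
  have large (c' l : ℕ) (hL : l ≤ L) :
      (L + 1 - l + c') / (L + 1) + (L + 1 - l + c' + l) / (L + 1) =
        c' / (L + 1) + (c' + (L + 1 - l)) / (L + 1) + 1 := by
    rw [show L + 1 - l + c' + l = c' + (L + 1) by omega, Nat.add_div_right _ (by omega),
      add_comm (L + 1 - l) c']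
    omega
  induction n generalizing c l with
  | zero =>
    rw [degreeThreshold]
    rcases Nat.lt_or_ge c (L + 1 - l) with h | h
    · simp only [small hl h, h, zero_add, zero_lt_one]
    · obtain ⟨c', rfl⟩ := Nat.exists_eq_add_of_le h
      rw [large c' l hL]
      exact iff_of_false (by simp) (by simp)
  | succ n ih =>
    rw [degreeThreshold]
    rcases Nat.lt_or_ge c (L + 1 - l) with h | h
    · rw [small hl h]
      omega
    · obtain ⟨c', rfl⟩ := Nat.exists_eq_add_of_le h
      rw [large c' l hL, Nat.add_lt_add_iff_right, Nat.add_lt_add_iff_left]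
      exact ih (by omega) (by omega) c'

theorem lDegree_natCast (L l c : ℕ) :
    lDegree L l c = ((c / (L + 1) + (c + l) / (L + 1) : ℕ) : ℕ∞) := rfl

theorem lDegree_top (L l : ℕ) : lDegree L l ⊤ = ⊤ := rfl

theorem lDegree_lt_iff {L l : ℕ} (hl : 0 < l) (hL : l ≤ L) (n : ℕ) (c : ℕ∞) :
    lDegree L l c < (n + 1 : ℕ) ↔ c < degreeThreshold L l n := by
  induction c using ENat.recTopCoe with
  | top => simp [lDegree_top]
  | coe c => rw [lDegree_natCast, Nat.cast_lt, Nat.cast_lt, div_add_div_lt_iff hl hL]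

theorem lDegree_lt_top_iff {L l : ℕ} {c : ℕ∞} : lDegree L l c < ⊤ ↔ c < ⊤ := by
  induction c using ENat.recTopCoe with
  | top => simp [lDegree_top]
  | coe c => simp only [lDegree_natCast, ENat.natCast_lt_top]

theorem lDegree_mono_left {L l l' : ℕ} (h : l ≤ l') (c : ℕ∞) : lDegree L l c ≤ lDegree L l' c := by
  induction c using ENat.recTopCoe with
  | top => simp [lDegree_top]
  | coe c =>
    rw [lDegree_natCast, lDegree_natCast, Nat.cast_le]
    gcongr

theorem lDegree_le_one_add {L l l' : ℕ} (h : l' ≤ L) (c : ℕ∞) :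
    lDegree L l' c ≤ 1 + lDegree L l c := by
  induction c using ENat.recTopCoe with
  | top => simp [lDegree_top]
  | coe c =>
    rw [lDegree_natCast, lDegree_natCast]
    have h₁ : (c + l') / (L + 1) ≤ (c + l) / (L + 1) + 1 := by
      rw [← Nat.add_div_right _ (Nat.succ_pos L)]
      exact Nat.div_le_div_right (by omega)
    exact_mod_cast (by omega)

/-! ### The syzygy of a path ideal and its projective dimension -/

section Syzygy

open PathAlgebra CategoryTheory

variable (K : Type u) {V : Type v} [Field K] [Quiver.{w} V] [Fintype V]

/-- The left ideal `Λ p` generated by a path `p`. -/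
noncomputable abbrev pathIdeal (L : ℕ) {a b : V} (p : Quiver.Path a b) :
    Ideal (TruncatedAlgebra K V L) :=
  Ideal.span {residue K L p}

/-- The paths of length `k` starting in the vertex `e`. -/
abbrev PathsFrom (e : V) (k : ℕ) : Type (max v w) :=
  Σ b : V, {p : Quiver.Path e b // p.length = k}

theorem pathIdeal_le_pathIdeal_nil (L : ℕ) {a b : V} (p : Quiver.Path a b) :
    pathIdeal K L p ≤ pathIdeal K L (Quiver.Path.nil : Quiver.Path a a) := by
  rw [Ideal.span_singleton_le_iff_mem, Ideal.mem_span_singleton']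
  exact ⟨residue K L p, by rw [← residue_comp, Quiver.Path.nil_comp]⟩

/-- The trivial path is idempotent, so right multiplication by it splits `Λe` off `Λ`. -/
theorem projective_pathIdeal_nil (L : ℕ) (e : V) :
    Module.Projective (TruncatedAlgebra K V L)
      (pathIdeal K L (Quiver.Path.nil : Quiver.Path e e)) := by
  refine Module.Projective.of_split (M := TruncatedAlgebra K V L) (Submodule.subtype _)
    ((LinearMap.toSpanSingleton _ _ (residue K L (Quiver.Path.nil : Quiver.Path e e))).codRestrict _
      fun x => Ideal.mul_mem_left _ _ (Ideal.mem_span_singleton_self _)) ?_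
  ext ⟨x, hx⟩
  obtain ⟨y, rfl⟩ := Ideal.mem_span_singleton'.1 hx
  change y * _ * _ = y * _
  rw [mul_assoc, ← residue_comp, Quiver.Path.nil_comp]

/-- The inclusion of the sum of the left ideals `Λ p`, over the paths `p` of length `k` starting in
`e`, into `Λ e`. -/
noncomputable def sumInclusion (L : ℕ) (e : V) (k : ℕ) :
    (Π₀ t : PathsFrom e k, pathIdeal K L t.2.1) →ₗ[TruncatedAlgebra K V L]
      pathIdeal K L (Quiver.Path.nil : Quiver.Path e e) :=
  open Classical in
  DFinsupp.coprodMap fun t => Submodule.inclusion (pathIdeal_le_pathIdeal_nil K L t.2.1)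

theorem sumInclusion_single (L : ℕ) (e : V) (k : ℕ)
    [DecidableEq (PathsFrom e k)] (t : PathsFrom e k) (x : pathIdeal K L t.2.1) :
    (sumInclusion K L e k (DFinsupp.single t x) : TruncatedAlgebra K V L) = x := by
  have h : sumInclusion K L e k (DFinsupp.single t x) =
      Submodule.inclusion (pathIdeal_le_pathIdeal_nil K L t.2.1) x := by
    unfold sumInclusion
    convert DFinsupp.coprodMap_apply_single
      (fun t : PathsFrom e k => Submodule.inclusion (pathIdeal_le_pathIdeal_nil K L t.2.1)) t x
  rw [h, Submodule.coe_inclusion]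

/-- The right multiplication by a path `q` ending in `e`, as a map from `Λ e` onto `Λ q`. -/
noncomputable def mulPathRight (L : ℕ) {a e : V} (q : Quiver.Path a e) :
    pathIdeal K L (Quiver.Path.nil : Quiver.Path e e) →ₗ[TruncatedAlgebra K V L]
      pathIdeal K L q :=
  ((LinearMap.toSpanSingleton _ _ (residue K L q)).domRestrict _).codRestrict _
    fun x => Ideal.mul_mem_left _ x.1 (Ideal.mem_span_singleton_self _)

theorem coe_mulPathRight (L : ℕ) {a e : V} (q : Quiver.Path a e)
    (x : pathIdeal K L (Quiver.Path.nil : Quiver.Path e e)) :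
    (mulPathRight K L q x : TruncatedAlgebra K V L) = x * residue K L q := rfl

theorem mulPathRight_surjective (L : ℕ) {a e : V} (q : Quiver.Path a e) :
    Function.Surjective (mulPathRight K L q) := by
  rintro ⟨x, hx⟩
  obtain ⟨y, rfl⟩ := Ideal.mem_span_singleton'.1 hx
  refine ⟨⟨y * residue K L .nil, Ideal.mul_mem_left _ _ (Ideal.mem_span_singleton_self _)⟩,
    Subtype.ext ?_⟩
  rw [coe_mulPathRight, mul_assoc, ← residue_comp, Quiver.Path.comp_nil]

variable {K} in
theorem exists_comp_of_truncCoeff_ne_zero {L : ℕ} {a b : V} (p : Quiver.Path a b)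
    {x : TruncatedAlgebra K V L} (hx : x ∈ pathIdeal K L p) {t : QPath V}
    (ht : t.path.length ≤ L) (h : truncCoeff L t x ≠ 0) :
    ∃ (c : V) (s : Quiver.Path b c), t = ⟨a, c, p.comp s⟩ := by
  obtain ⟨y, rfl⟩ := Ideal.mem_span_singleton'.1 hx
  obtain ⟨y, rfl⟩ := toTruncated_surjective L y
  unfold residue at h
  rw [← map_mul, truncCoeff_toTruncated ht] at h
  exact exists_comp_of_coeff_mul_ofPath_ne_zero p y h

theorem sumInclusion_injective (L : ℕ) (e : V) (k : ℕ) :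
    Function.Injective (sumInclusion K L e k) := by
  classical
  rw [injective_iff_map_eq_zero]
  intro x hx
  have hsum : ∀ t : QPath V, ∑ i ∈ x.support, truncCoeff L t (x i : TruncatedAlgebra K V L) = 0 := by
    intro t
    rw [← map_sum]
    have : (sumInclusion K L e k x : TruncatedAlgebra K V L) =
        ∑ i ∈ x.support, (x i : TruncatedAlgebra K V L) := by
      conv_lhs => rw [← DFinsupp.sum_single (f := x)]
      rw [DFinsupp.sum, map_sum, Submodule.coe_sum]
      exact Finset.sum_congr rfl fun i _ => sumInclusion_single K L e k i _
    rw [← this, hx, Submodule.coe_zero, map_zero]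
  refine DFinsupp.ext fun i => Subtype.ext (eq_zero_of_truncCoeff fun t ht => ?_)
  by_contra h
  refine h ((Finset.sum_eq_single i ?_ ?_).symm.trans (hsum t))
  · intro j _ hji
    by_contra hj
    obtain ⟨c, s, rfl⟩ := exists_comp_of_truncCoeff_ne_zero i.2.1 (x i).2 ht h
    obtain ⟨c', s', hs⟩ := exists_comp_of_truncCoeff_ne_zero j.2.1 (x j).2 ht hj
    obtain rfl : c = c' := congrArg QPath.target hs
    simp only [QPath.mk.injEq, heq_eq_eq, true_and] at hs
    -- A basis path in both summands has two initial segments of the same length, which must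
    -- coincide.
    have := QPath.eq_of_comp_eq_comp _ _ _ _ (i.2.2.trans j.2.2.symm) hs
    obtain ⟨b, p, hp⟩ := i
    obtain ⟨b', p', hp'⟩ := j
    cases this
    exact hji rfl
  · intro hi
    rw [DFinsupp.notMem_support_iff.1 hi, Submodule.coe_zero, map_zero]

theorem exact_sumInclusion_mulPathRight (L : ℕ) {a e : V} (q : Quiver.Path a e)
    (hqL : q.length ≤ L) :
    Function.Exact (sumInclusion K L e (L + 1 - q.length)) (mulPathRight K L q) := by
  classical
  set k := L + 1 - q.length with hk
  rw [LinearMap.exact_iff]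
  apply le_antisymm
  · have hrange : Ideal.span (Set.range fun t : PathsFrom e k => residue K L t.2.1) ≤
        LinearMap.range ((Submodule.subtype _).comp (sumInclusion K L e k)) := by
      refine Submodule.span_le.2 ?_
      rintro _ ⟨t, rfl⟩
      exact ⟨DFinsupp.single t ⟨_, Ideal.mem_span_singleton_self _⟩, sumInclusion_single K L e k t _⟩
    rintro ⟨x, hx⟩ h0
    suffices x ∈ Ideal.span (Set.range fun t : PathsFrom e k => residue K L t.2.1) by
      obtain ⟨y, hy⟩ := hrange this
      exact ⟨y, Subtype.ext hy⟩
    obtain ⟨y, rfl⟩ := Ideal.mem_span_singleton'.1 hx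
    obtain ⟨y, rfl⟩ := toTruncated_surjective L y
    have h0' : toTruncated K V L (y * ofPath (.nil : Quiver.Path e e) * ofPath q) = 0 := by
      rw [map_mul, map_mul]
      exact congrArg Subtype.val h0
    change toTruncated K V L y * toTruncated K V L (ofPath .nil) ∈
      Ideal.span (Set.range fun t : PathsFrom e k => residue K L t.2.1)
    rw [← map_mul]
    refine mem_of_coeff_ne_zero (AddSubmonoid.comap (toTruncated K V L).toAddMonoidHom
      (Ideal.span (Set.range fun t : PathsFrom e k => residue K L t.2.1)).toAddSubmonoid)
      _ fun {a' b} p hp r => ?_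
    obtain ⟨c, s, hs⟩ := exists_comp_of_coeff_mul_ofPath_ne_zero _ _ hp
    rw [Quiver.Path.nil_comp] at hs
    cases hs
    -- If `p` were shorter, `q` followed by `p` would survive in `Λ`, with the coefficient that `p`
    -- has in the given element; but the image of that element is zero.
    have hlen : k ≤ p.length := by
      by_contra hlt
      have := toTruncated_eq_zero_iff.1 h0' ⟨a, b, q.comp p⟩
        (by rw [Quiver.Path.length_comp]; omega)
      rw [coeff_comp_mul_ofPath] at this
      exact hp this
    obtain ⟨c, p₁, p₂, hp₁, rfl⟩ := exists_comp_eq_of_le_length p hlen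
    change toTruncated K V L (r • ofPath (p₁.comp p₂)) ∈
      Ideal.span (Set.range fun t : PathsFrom e k => residue K L t.2.1)
    rw [← ofPath_mul_ofPath_of_eq, ← PathAlgebra.smul_mul', map_mul]
    exact Ideal.mul_mem_left _ _ (Ideal.subset_span ⟨⟨c, p₁, hp₁⟩, rfl⟩)
  · rintro _ ⟨x, rfl⟩
    induction x using DFinsupp.induction with
    | h0 => rw [map_zero]; exact zero_mem _
    | ha t x f _ _ ih =>
      rw [map_add]
      refine add_mem (Subtype.ext ?_) ih
      rw [coe_mulPathRight, sumInclusion_single]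
      obtain ⟨y, hy⟩ := Ideal.mem_span_singleton'.1 x.2
      rw [← hy, mul_assoc, ← residue_comp, residue_eq_zero, mul_zero, Submodule.coe_zero]
      rw [Quiver.Path.length_comp, t.2.2]
      omega

/-- The short exact sequence `0 → ⨁ Λ p → Λ e → Λ q → 0`, where `q` ends in `e` and the sum is over
the paths `p` of length `L + 1 - len(q)` starting in `e`. -/
noncomputable def syzygySequence (L : ℕ) {a e : V} (q : Quiver.Path a e) (hqL : q.length ≤ L) :
    ShortComplex (ModuleCat.{max u v w} (TruncatedAlgebra K V L)) :=
  ShortComplex.mk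
    (X₁ := ModuleCat.of _ (Π₀ t : PathsFrom e (L + 1 - q.length), pathIdeal K L t.2.1))
    (X₂ := ModuleCat.of _ (pathIdeal K L (Quiver.Path.nil : Quiver.Path e e)))
    (X₃ := ModuleCat.of _ (pathIdeal K L q))
    (ModuleCat.ofHom (sumInclusion K L e (L + 1 - q.length)))
    (ModuleCat.ofHom (mulPathRight K L q))
    (ModuleCat.hom_ext (exact_sumInclusion_mulPathRight K L q hqL).linearMap_comp_eq_zero)

theorem syzygySequence_shortExact (L : ℕ) {a e : V} (q : Quiver.Path a e) (hqL : q.length ≤ L) :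
    (syzygySequence K L q hqL).ShortExact :=
  ModuleCat.shortComplex_shortExact _ (exact_sumInclusion_mulPathRight K L q hqL)
    (sumInclusion_injective K L e _) (mulPathRight_surjective K L q)

/-- Suppose `s` splits `Λe → Λq` and `p` is a path from `e` of length `L + 1 - len(q)`. Then `p *
s(q) = s(p * q) = 0`. But `s(q) * q = q` forces coefficient 1 at the trivial path in `s(q)`, hence
coefficient 1 at `p` in `p * s(q)`; this is visible in `Λ` because `len(q) > 0` gives `len(p) ≤ L`.
If no such `p` exists, the syzygy vanishes and `Λq ≅ Λe`. -/
theorem projective_pathIdeal_iff (L : ℕ) {a e : V} (q : Quiver.Path a e) (hq : 0 < q.length)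
    (hqL : q.length ≤ L) :
    Module.Projective (TruncatedAlgebra K V L) (pathIdeal K L q) ↔
      IsEmpty (PathsFrom e (L + 1 - q.length)) := by
  constructor
  · refine fun h => ⟨fun ⟨b, p, hp⟩ => ?_⟩
    obtain ⟨s, hs⟩ := Module.projective_lifting_property (mulPathRight K L q) LinearMap.id
      (mulPathRight_surjective K L q)
    let q₀ : pathIdeal K L q := ⟨residue K L q, Ideal.mem_span_singleton_self _⟩
    obtain ⟨y, hy⟩ := toTruncated_surjective L (s q₀ : TruncatedAlgebra K V L)
    have h₁ : residue K L p * (s q₀ : TruncatedAlgebra K V L) = 0 := by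
      have : residue K L p • q₀ = 0 := Subtype.ext <| by
        change residue K L p * residue K L q = 0
        rw [← residue_comp, residue_eq_zero]
        rw [Quiver.Path.length_comp]
        omega
      rw [← smul_eq_mul, ← Submodule.coe_smul, ← map_smul, this, map_zero, Submodule.coe_zero]
    have h₂ : (s q₀ : TruncatedAlgebra K V L) * residue K L q = residue K L q :=
      congrArg Subtype.val (LinearMap.congr_fun hs q₀)
    have h₃ : coeff ⟨e, e, .nil⟩ y = 1 := by
      rw [← coeff_comp_mul_ofPath q .nil y, Quiver.Path.comp_nil,
        ← truncCoeff_toTruncated (L := L) hqL, map_mul, hy]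
      change truncCoeff L _ (_ * residue K L q) = 1
      rw [h₂]
      exact (truncCoeff_toTruncated (L := L) hqL _).trans (coeff_ofPath_self q)
    have h₄ := congrArg (truncCoeff L ⟨e, b, p⟩) h₁
    rw [← hy, map_zero] at h₄
    change truncCoeff L _ (toTruncated K V L (ofPath p) * _) = 0 at h₄
    rw [← map_mul, truncCoeff_toTruncated (show p.length ≤ L by omega), coeff_ofPath_mul, h₃] at h₄
    exact one_ne_zero h₄
  · intro h
    have hbij : Function.Bijective (mulPathRight K L q) := by
      refine ⟨(injective_iff_map_eq_zero _).2 fun x hx => ?_, mulPathRight_surjective K L q⟩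
      obtain ⟨y, rfl⟩ := (exact_sumInclusion_mulPathRight K L q hqL x).1 hx
      rw [Subsingleton.elim y 0, map_zero]
    have := projective_pathIdeal_nil K L e
    exact Module.Projective.of_equiv (LinearEquiv.ofBijective _ hbij)

/-- Each step trades `q` for the paths `p` of its syzygy, whose common length `L + 1 - len(q)` again
lies between 1 and `L`. -/
theorem hasProjectiveDimensionLT_pathIdeal_iff (L : ℕ) (n : ℕ) {a e : V} (q : Quiver.Path a e)
    (hq : 0 < q.length) (hqL : q.length ≤ L) :
    HasProjectiveDimensionLT (ModuleCat.of (TruncatedAlgebra K V L) (pathIdeal K L q)) (n + 1) ↔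
      supLength e < degreeThreshold L q.length n := by
  induction n generalizing a e with
  | zero =>
    rw [zero_add, ← projective_iff_hasProjectiveDimensionLT_one, ← IsProjective.iff_projective,
      projective_pathIdeal_iff K L q hq hqL, degreeThreshold, supLength_lt_natCast_iff]
    simp [isEmpty_sigma, isEmpty_subtype]
  | succ n ih =>
    have hX₂ : Projective (syzygySequence K L q hqL).X₂ :=
      (IsProjective.iff_projective _).1 (projective_pathIdeal_nil K L e)
    rw [degreeThreshold, supLength_lt_natCast_add_iff]
    refine ((syzygySequence_shortExact K L q hqL).hasProjectiveDimensionLT_X₃_iff n hX₂).trans ?_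
    refine (hasProjectiveDimensionLT_dfinsupp_iff (n + 1) _).trans ?_
    constructor
    · intro h b p hp
      rw [← hp]
      exact (ih p (by omega) (by omega)).1 (h ⟨b, p, hp⟩)
    · rintro h ⟨b, p, hp⟩
      refine (ih p (by omega) (by omega)).2 ?_
      rw [hp]
      exact h b p hp

theorem pdimPath_eq_lDegree (L : ℕ) {a e : V} (q : Quiver.Path a e) (hq : 0 < q.length)
    (hqL : q.length ≤ L) :
    pdimPath K L q = ((lDegree L q.length (supLength e) : ℕ∞) : WithBot ℕ∞) := by
  have hlt (n : ℕ) : pdimPath K L q < (n : WithBot ℕ∞) ↔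
      ((lDegree L q.length (supLength e) : ℕ∞) : WithBot ℕ∞) < (n : WithBot ℕ∞) := by
    cases n with
    | zero =>
      -- The value `⊥` belongs to the zero module only, and `Λq` contains the nonzero class of `q`.
      refine iff_of_false ?_ (not_lt.2 (by exact_mod_cast zero_le))
      unfold pdimPath
      rw [projectiveDimension_lt_iff, hasProjectiveDimensionLT_zero_iff_isZero,
        ModuleCat.isZero_of_iff_subsingleton]
      intro h
      exact residue_ne_zero K q hqL (congrArg Subtype.val
        (h.elim ⟨residue K L q, Ideal.mem_span_singleton_self _⟩ 0))
    | succ n =>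
      unfold pdimPath
      rw [projectiveDimension_lt_iff, hasProjectiveDimensionLT_pathIdeal_iff K L n q hq hqL,
        ← lDegree_lt_iff hq hqL]
      exact_mod_cast Iff.rfl
  -- An element of `WithBot ℕ∞` is determined by the natural numbers strictly above it.
  have key {x y : WithBot ℕ∞} (h : ∀ n : ℕ, x < n ↔ y < n) : x ≤ y := by
    induction y with
    | bot =>
      have := (h 0).2 (WithBot.bot_lt_coe _)
      exact (WithBot.lt_coe_bot.1 this).le
    | coe y =>
      induction y using ENat.recTopCoe with
      | top => exact le_top
      | coe m =>
        refine (ENat.WithBot.lt_add_one_iff (m := m)).1 ?_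
        have := (h (m + 1)).2 (by exact_mod_cast Nat.lt_succ_self m)
        exact_mod_cast this
  exact le_antisymm (key hlt) (key fun n => (hlt n).symm)

end Syzygy

end TruncatedPathAlgebra

theorem theorem5 {K : Type*} [Field K] {V : Type*} [Fintype V] [Quiver V] (L : ℕ)
    {a e : V} (q : Quiver.Path a e) (hq : 0 < q.length) (hqL : q.length ≤ L) :
    TruncatedPathAlgebra.pdimPath K L q =
        ((TruncatedPathAlgebra.lDegree L q.length (TruncatedPathAlgebra.supLength e) : ℕ∞) :
          WithBot ℕ∞) ∧
      (TruncatedPathAlgebra.pdimPath K L q < ⊤ ↔ TruncatedPathAlgebra.supLength e < ⊤) ∧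
      (TruncatedPathAlgebra.supLength e < ⊤ ↔ ¬ TruncatedPathAlgebra.Cyclebound e) ∧
      ∀ {a' : V} (q' : Quiver.Path a' e), q.length ≤ q'.length → q'.length ≤ L →
        TruncatedPathAlgebra.pdimPath K L q ≤ TruncatedPathAlgebra.pdimPath K L q' ∧
          TruncatedPathAlgebra.pdimPath K L q' ≤ 1 + TruncatedPathAlgebra.pdimPath K L q := by

  open TruncatedPathAlgebra in
  refine ⟨pdimPath_eq_lDegree K L q hq hqL, ?_, supLength_lt_top_iff_not_cyclebound e,
    fun q' hqq' hqL' => ?_⟩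
  · rw [pdimPath_eq_lDegree K L q hq hqL, ← lDegree_lt_top_iff (L := L) (l := q.length)]
    exact WithBot.coe_lt_coe
  · rw [pdimPath_eq_lDegree K L q hq hqL, pdimPath_eq_lDegree K L q' (hq.trans_le hqq') hqL']
    exact ⟨WithBot.coe_le_coe.2 (lDegree_mono_left hqq' _),
      WithBot.coe_le_coe.2 (lDegree_le_one_add hqL' _)⟩
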